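/- For an abelian group $G$ and a finite subset $A \subseteq G$, write $$\hat{2}A = \{a_1 + a_2 \mid a_1, a_2 \in A,\ a_1 \neq a_2\}$$ for its restricted sumset, and for a positive integer $m$ such that $G$ has a subset of size $m$ let $$\rho(G, m) = \min\{|\hat{2}A| \mid A \subseteq G,\ |A| = m\}.$$ Let $\mathbb{Z}_p = \mathbb{Z}/p\mathbb{Z}$ and $\mathbb{Z}_p^2 = \mathbb{Z}_p \times \mathbb{Z}_p$. **Theorem.** If $p \geq 5$ is prime, then $$\rho(\mathbb{Z}_p^2, 2p+1) = 4p.$$ That is, every subset $A \subseteq \mathbb{Z}_p^2$ with $|A| = 2p+1$ satisfies $|\hat{2}A| \geq 4p$, and some such $A$ satisfies $|\hat{2}A| = 4p$. -/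

import Mathlib

/-- The restricted sumset of `A` and `B`: all sums `a + b` with `a ∈ A`, `b ∈ B` and `a ≠ b`. -/
def restrictedSumset {G : Type*} [AddCommGroup G] [DecidableEq G] (A B : Finset G) : Finset G :=
  ((A ×ˢ B).filter (fun x => x.1 ≠ x.2)).image (fun x => x.1 + x.2)

theorem mem_restrictedSumset {G : Type*} [AddCommGroup G] [DecidableEq G] {A B : Finset G} {g : G} :
    g ∈ restrictedSumset A B ↔ ∃ a ∈ A, ∃ b ∈ B, a ≠ b ∧ a + b = g := by
  simp only [restrictedSumset, Finset.mem_image, Finset.mem_filter, Finset.mem_product, Prod.exists]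
  constructor
  · rintro ⟨a, b, ⟨⟨ha, hb⟩, hab⟩, h⟩
    exact ⟨a, ha, b, hb, hab, h⟩
  · rintro ⟨a, ha, b, hb, hab, h⟩
    exact ⟨a, b, ⟨⟨ha, hb⟩, hab⟩, h⟩

/-- The least size of the restricted sumset of `A` with itself, over all `m`-element subsets `A`
of `G`. It is a true minimum as soon as `G` has an `m`-element subset (see `isLeast_rho`). -/
noncomputable def rho (G : Type*) [AddCommGroup G] [DecidableEq G] (m : ℕ) : ℕ :=
  sInf {n : ℕ | ∃ A : Finset G, A.card = m ∧ (restrictedSumset A A).card = n}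

theorem isLeast_rho (G : Type*) [AddCommGroup G] [DecidableEq G] (m : ℕ)
    (h : ∃ A : Finset G, A.card = m) :
    IsLeast {n : ℕ | ∃ A : Finset G, A.card = m ∧ (restrictedSumset A A).card = n} (rho G m) := by
  obtain ⟨A, hA⟩ := h
  exact ⟨Nat.sInf_mem ⟨_, A, hA, rfl⟩, fun _ hn => Nat.sInf_le hn⟩

/-! Suppose `A` has fewer than `4 * p` restricted sums. A translation makes its sum zero, and `(u,
v) ↦ u + v * X` turns it into a set `S` in the field of rational functions over `ZMod p`. Some monic
`P` of degree `4 * p - 1` vanishes on the restricted sums, so `(x - y) * P (x + y)` and all its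
monomial multiples vanish on `S × S`. Weighted summation, as in the coefficient formula behind the
Combinatorial Nullstellensatz, turns this into relations between the moments `weightedPowerSum S`.
Their coefficients are evaluated by Lucas' theorem, and an induction starting from the zero sum
kills `p - 2` moments (`AnnihilatesForms.eq_zero`); hence the power sums of `S` of exponents `1, …,
p - 2` vanish. Specialising `X`, every nonzero linear form on the plane has these vanishing power
sums on `A`, so its fibre sizes are constant modulo `p` except for an extra `1` over zero
(`natCast_card_fiber`). Either `A` is two parallel lines and a point, which has enough sums, or
every line through the origin meets `A` in exactly three points (`card_filter_eq_three`). Counting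
over all `p + 1` such lines refutes the latter. -/

section WeightedPowerSums

/-! ### Weighted power sums and ordinary power sums -/

open Polynomial

variable {K : Type*} [Field K]

/-- The weighted power sum `∑ s ^ i / ∏_{t ≠ s} (s - t)` over a finite set of nodes. It extracts the
coefficient of degree `#S - 1` of the reduction of `X ^ i` modulo the nodal polynomial of `S`. -/
noncomputable def weightedPowerSum [DecidableEq K] (S : Finset K) (i : ℕ) : K :=
  ∑ s ∈ S, s ^ i / ∏ t ∈ S.erase s, (s - t)

/-- The coefficient of `x ^ k * y ^ (N + 1 - k)` in `(x - y) * (x + y) ^ N`. -/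
def ballotCoeff (K : Type*) [Field K] (N k : ℕ) : K :=
  (if k = 0 then 0 else (N.choose (k - 1) : K)) - N.choose k

theorem sum_ballotCoeff (N : ℕ) (x y : K) :
    ∑ k ∈ Finset.range (N + 2), ballotCoeff K N k * x ^ k * y ^ (N + 1 - k) =
      (x - y) * (x + y) ^ N := by
  have h1 : ∑ k ∈ Finset.range (N + 2), (if k = 0 then 0 else (N.choose (k - 1) : K)) * x ^ k *
      y ^ (N + 1 - k) = x * (x + y) ^ N := by
    rw [Finset.sum_range_succ', add_pow, Finset.mul_sum]
    simp only [Nat.add_sub_add_right]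
    simp only [Nat.add_eq_zero_iff, one_ne_zero, and_false, if_false, if_true, zero_mul, add_zero,
      Nat.add_sub_cancel]
    exact Finset.sum_congr rfl fun k _ => by ring
  have h2 : ∑ k ∈ Finset.range (N + 2), (N.choose k : K) * x ^ k * y ^ (N + 1 - k) =
      y * (x + y) ^ N := by
    rw [Finset.sum_range_succ, add_pow, Finset.mul_sum, Nat.choose_succ_self]
    simp only [Nat.cast_zero, zero_mul, add_zero]
    refine Finset.sum_congr rfl fun k hk => ?_
    rw [Nat.sub_add_comm (Nat.lt_succ_iff.mp (Finset.mem_range.mp hk)), pow_succ]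
    ring
  simp only [ballotCoeff, sub_mul, Finset.sum_sub_distrib]
  rw [h1, h2]

variable [DecidableEq K] {S : Finset K}

/-- Interpolation reproduces `X ^ i` when `i < #S`, so the weighted sum is its coefficient in degree
`#S - 1`. -/
theorem weightedPowerSum_of_lt {i : ℕ} (hi : i + 1 < S.card) : weightedPowerSum S i = 0 := by
  have h := Lagrange.coeff_eq_sum (s := S) (v := id) (P := (X : K[X]) ^ i)
    Function.injective_id.injOn (by rw [degree_X_pow]; exact_mod_cast (by omega : i < S.card))
  rw [coeff_X_pow, if_neg (by omega)] at h
  simpa [weightedPowerSum] using h.symm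

theorem weightedPowerSum_pred {i : ℕ} (hi : i + 1 = S.card) : weightedPowerSum S i = 1 := by
  have h := Lagrange.coeff_eq_sum (s := S) (v := id) (P := (X : K[X]) ^ i)
    Function.injective_id.injOn (by rw [degree_X_pow]; exact_mod_cast (by omega : i < S.card))
  rw [coeff_X_pow, if_pos (by omega)] at h
  simpa [weightedPowerSum] using h.symm

/-- If `P` is a polynomial vanishing on the sums of distinct elements of `S`, then the form
`x ^ a * y ^ b * (x - y) * P (x + y)` is killed by weighted summation in both variables. -/
theorem sum_coeff_mul_ballotCoeff (P : K[X]) (hP : ∀ s ∈ S, ∀ t ∈ S, s ≠ t → P.eval (s + t) = 0)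
    {d : ℕ} (hd : P.natDegree < d) (a b : ℕ) :
    ∑ N ∈ Finset.range d, ∑ k ∈ Finset.range (N + 2), P.coeff N * ballotCoeff K N k *
      (weightedPowerSum S (a + k) * weightedPowerSum S (b + (N + 1 - k))) = 0 := by
  have key : ∀ s ∈ S, ∀ t ∈ S, s ^ a * t ^ b * ((s - t) * P.eval (s + t)) = 0 := by
    intro s hs t ht
    -- The factor `s - t` covers the diagonal, where `P` need not vanish.
    by_cases h : s = t
    · simp [h]
    · simp [hP s hs t ht h]
  set w : K → K := fun s => (∏ t ∈ S.erase s, (s - t))⁻¹ with hw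
  have h0 : ∑ s ∈ S, ∑ t ∈ S, w s * w t * (s ^ a * t ^ b * ((s - t) * P.eval (s + t))) = 0 :=
    Finset.sum_eq_zero fun s hs => Finset.sum_eq_zero fun t ht => by rw [key s hs t ht, mul_zero]
  have hexp : ∀ s t : K, s ^ a * t ^ b * ((s - t) * P.eval (s + t)) =
      ∑ N ∈ Finset.range d, ∑ k ∈ Finset.range (N + 2), P.coeff N * ballotCoeff K N k *
        (s ^ (a + k) * t ^ (b + (N + 1 - k))) := by
    intro s t
    rw [eval_eq_sum_range' hd, Finset.mul_sum, Finset.mul_sum]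
    refine Finset.sum_congr rfl fun N _ => ?_
    rw [mul_left_comm (s - t), ← sum_ballotCoeff, Finset.mul_sum, Finset.mul_sum]
    exact Finset.sum_congr rfl fun k _ => by ring
  rw [← h0]
  simp_rw [hexp, Finset.mul_sum]
  symm
  calc _ = ∑ s ∈ S, ∑ N ∈ Finset.range d, ∑ k ∈ Finset.range (N + 2), ∑ t ∈ S, w s * w t *
        (P.coeff N * ballotCoeff K N k * (s ^ (a + k) * t ^ (b + (N + 1 - k)))) := by
        refine Finset.sum_congr rfl fun s _ => ?_
        rw [Finset.sum_comm]
        exact Finset.sum_congr rfl fun N _ => Finset.sum_comm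
    _ = ∑ N ∈ Finset.range d, ∑ k ∈ Finset.range (N + 2), ∑ s ∈ S, ∑ t ∈ S, w s * w t *
        (P.coeff N * ballotCoeff K N k * (s ^ (a + k) * t ^ (b + (N + 1 - k)))) := by
        rw [Finset.sum_comm]
        exact Finset.sum_congr rfl fun N _ => Finset.sum_comm
    _ = _ := by
        refine Finset.sum_congr rfl fun N _ => Finset.sum_congr rfl fun k _ => ?_
        simp only [weightedPowerSum]
        rw [Finset.sum_mul_sum, Finset.mul_sum]
        refine Finset.sum_congr rfl fun s _ => ?_
        rw [Finset.mul_sum]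
        refine Finset.sum_congr rfl fun t _ => ?_
        simp only [hw, div_eq_mul_inv]
        ring

/-- The nodal polynomial vanishes at each node, so its coefficients give a linear recurrence for the
moments. -/
theorem sum_coeff_nodal_mul_weightedPowerSum (i : ℕ) :
    ∑ k ∈ Finset.range (S.card + 1),
      (Lagrange.nodal S id).coeff k * weightedPowerSum S (k + i) = 0 := by
  have h : ∀ s ∈ S, ∑ k ∈ Finset.range (S.card + 1), (Lagrange.nodal S id).coeff k * s ^ k = 0 := by
    intro s hs
    rw [← eval_eq_sum_range' (by rw [Lagrange.natDegree_nodal]; omega)]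
    exact Lagrange.eval_nodal_at_node (v := id) hs
  simp only [weightedPowerSum, Finset.mul_sum]
  rw [Finset.sum_comm]
  refine Finset.sum_eq_zero fun s hs => ?_
  rw [← mul_zero (s ^ i / ∏ t ∈ S.erase s, (s - t)), ← h s hs, Finset.mul_sum]
  exact Finset.sum_congr rfl fun k _ => by ring

/-- The weight at `s` is the inverse of the derivative of the nodal polynomial at `s`; inserting
that derivative cancels it. -/
theorem sum_pow_eq_sum_weightedPowerSum (i : ℕ) :
    ∑ s ∈ S, s ^ i = ∑ k ∈ Finset.range (S.card + 1),
      (derivative (Lagrange.nodal S id)).coeff k * weightedPowerSum S (k + i) := by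
  simp only [weightedPowerSum, Finset.mul_sum]
  rw [Finset.sum_comm]
  refine Finset.sum_congr rfl fun s hs => ?_
  have h : ∑ k ∈ Finset.range (S.card + 1), (derivative (Lagrange.nodal S id)).coeff k * s ^ k =
      ∏ t ∈ S.erase s, (s - t) := by
    rw [← eval_eq_sum_range' (lt_of_le_of_lt (natDegree_derivative_le _)
      (by rw [Lagrange.natDegree_nodal]; omega))]
    have := Lagrange.eval_nodal_derivative_eval_node_eq (v := (id : K → K)) hs
    rw [id, Lagrange.eval_nodal] at this
    simpa using this
  have h0 : ∏ t ∈ S.erase s, (s - t) ≠ 0 :=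
    Finset.prod_ne_zero_iff.mpr fun t ht => sub_ne_zero.mpr (Finset.ne_of_mem_erase ht).symm
  calc s ^ i = s ^ i / (∏ t ∈ S.erase s, (s - t)) * ∏ t ∈ S.erase s, (s - t) := by field_simp
    _ = _ := by
      nth_rewrite 2 [← h]
      rw [Finset.mul_sum]
      exact Finset.sum_congr rfl fun k _ => by ring

/-- In the recurrence shifted by `i - 1`, moments below the critical index vanish by degree and
those above it by `hm`, leaving one coefficient times `1`. -/
theorem coeff_nodal_eq_zero {m i : ℕ}
    (hm : ∀ l, 0 < l → l ≤ m → weightedPowerSum S (S.card - 1 + l) = 0) (hi : 0 < i)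
    (him : i ≤ m) (hic : i ≤ S.card) :
    (Lagrange.nodal S id).coeff (S.card - i) = 0 := by
  have h := sum_coeff_nodal_mul_weightedPowerSum (S := S) (i - 1)
  rw [Finset.sum_eq_single_of_mem (S.card - i) (by simp)] at h
  · rwa [weightedPowerSum_pred (by omega), mul_one] at h
  · intro k hk hne
    rw [Finset.mem_range] at hk
    rcases lt_or_gt_of_ne hne with h | h
    · rw [weightedPowerSum_of_lt (by omega), mul_zero]
    · rw [show k + (i - 1) = S.card - 1 + (k - (S.card - i)) by omega, hm _ (by omega) (by omega),
        mul_zero]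

theorem weightedPowerSum_card (hS : S.Nonempty) : weightedPowerSum S S.card = ∑ s ∈ S, s := by
  have hc := hS.card_pos
  have h := sum_coeff_nodal_mul_weightedPowerSum (S := S) 0
  rw [Finset.sum_range_succ, Finset.sum_eq_single_of_mem (S.card - 1) (by simp; omega)] at h
  · have h1 : (Lagrange.nodal S id).coeff S.card = 1 := by
      have := Lagrange.nodal_monic (s := S) (v := (id : K → K))
      rwa [Monic, leadingCoeff, Lagrange.natDegree_nodal] at this
    have h2 : (Lagrange.nodal S id).coeff (S.card - 1) = - ∑ s ∈ S, s := by
      rw [Lagrange.nodal_eq]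
      exact prod_X_sub_C_coeff_card_pred S id hc
    rw [h1, h2, add_zero, add_zero, weightedPowerSum_pred (by omega)] at h
    linear_combination h
  · intro k hk hne
    rw [Finset.mem_range] at hk
    rw [weightedPowerSum_of_lt (by omega), mul_zero]

/-- Vanishing of the weighted power sums of `S` just above the critical degree forces the power
sums of `S` to vanish. -/
theorem sum_pow_eq_zero {m i : ℕ}
    (hm : ∀ l, 0 < l → l ≤ m → weightedPowerSum S (S.card - 1 + l) = 0) (hi : 0 < i)
    (him : i ≤ m) (hic : i < S.card) : ∑ s ∈ S, s ^ i = 0 := by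
  rw [sum_pow_eq_sum_weightedPowerSum]
  refine Finset.sum_eq_zero fun k hk => ?_
  rw [Finset.mem_range] at hk
  -- Below the critical index the moment vanishes, at it the nodal coefficient does, and above it
  -- `hm` or the degree of the derivative applies.
  rcases lt_trichotomy (k + i + 1) S.card with h | h | h
  · rw [weightedPowerSum_of_lt h, mul_zero]
  · rw [coeff_derivative, show k + 1 = S.card - i by omega, coeff_nodal_eq_zero hm hi him hic.le,
      zero_mul, zero_mul]
  · by_cases hk' : S.card ≤ k
    · rw [coeff_eq_zero_of_natDegree_lt, zero_mul]
      refine lt_of_le_of_lt (natDegree_derivative_le _) ?_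
      rw [Lagrange.natDegree_nodal]; omega
    · rw [show k + i = S.card - 1 + (k + i + 1 - S.card) by omega, hm _ (by omega) (by omega),
        mul_zero]

end WeightedPowerSums

/-! ### Ballot coefficients in characteristic `p`, by Lucas' theorem -/

section BallotCoefficients

variable {K : Type*} [Field K] {p : ℕ} [CharP K p]

theorem cast_choose_add_mul (hp : p.Prime) {r s : ℕ} (hr : r < p) (hs : s < p) (u v : ℕ) :
    (((u * p + r).choose (v * p + s) : ℕ) : K) = (u.choose v : K) * r.choose s := by
  have := Fact.mk hp
  have h := Choose.choose_modEq_choose_mod_mul_choose_div_nat (p := p) (n := u * p + r)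
    (k := v * p + s)
  rw [Nat.mul_add_mod', Nat.mul_add_mod', Nat.mod_eq_of_lt hr, Nat.mod_eq_of_lt hs,
    Nat.add_div_of_dvd_right (Dvd.intro_left u rfl), Nat.add_div_of_dvd_right (Dvd.intro_left v rfl),
    Nat.mul_div_cancel _ hp.pos, Nat.mul_div_cancel _ hp.pos, Nat.div_eq_of_lt hr,
    Nat.div_eq_of_lt hs, add_zero, add_zero] at h
  rw [mul_comm (u.choose v : K), ← Nat.cast_mul, CharP.natCast_eq_natCast K p]
  exact h

theorem cast_choose_pred (hp : p.Prime) {s : ℕ} (hs : s < p) :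
    (((p - 1).choose s : ℕ) : K) = (-1) ^ s := by
  induction s with
  | zero => simp
  | succ s ih =>
    have h : p.choose (s + 1) = (p - 1).choose s + (p - 1).choose (s + 1) := by
      conv_lhs => rw [← Nat.sub_add_cancel hp.one_le]
      exact Nat.choose_succ_succ _ _
    have h0 : ((p.choose (s + 1) : ℕ) : K) = 0 :=
      (CharP.cast_eq_zero_iff K p _).mpr (hp.dvd_choose_self s.succ_ne_zero hs)
    rw [h, Nat.cast_add, ih (by omega)] at h0
    rw [pow_succ]
    linear_combination h0

theorem ballotCoeff_add_mul (hp : p.Prime) {r s : ℕ} (hr : r < p) (hs : s < p) (hs0 : 0 < s)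
    (u v : ℕ) : ballotCoeff K (u * p + r) (v * p + s) = (u.choose v : K) * ballotCoeff K r s := by
  rw [ballotCoeff, ballotCoeff, if_neg (by omega), if_neg (by omega), Nat.add_sub_assoc hs0,
    cast_choose_add_mul hp hr hs, cast_choose_add_mul hp hr (by omega), mul_sub]

/-- With lower digit zero, passing from `k` to `k - 1` borrows from the upper digit, so the two
binomials no longer share a factor. -/
theorem ballotCoeff_add_mul_self (hp : p.Prime) {r : ℕ} (hr : r < p) (u v : ℕ) :
    ballotCoeff K (u * p + r) ((v + 1) * p) =
      (u.choose v : K) * r.choose (p - 1) - u.choose (v + 1) := by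
  have h := cast_choose_add_mul (K := K) hp hr hp.pos u (v + 1)
  have := hp.pos
  rw [ballotCoeff, if_neg (by positivity), show (v + 1) * p - 1 = v * p + (p - 1) by
    rw [add_mul, one_mul, Nat.add_sub_assoc hp.one_le],
    cast_choose_add_mul hp hr (by omega)]
  rw [add_zero, Nat.choose_zero_right, Nat.cast_one, mul_one] at h
  rw [h]

theorem ballotCoeff_of_lt {N k : ℕ} (h : N + 1 < k) : ballotCoeff K N k = 0 := by
  rw [ballotCoeff, Nat.choose_eq_zero_of_lt (by omega), Nat.choose_eq_zero_of_lt (by omega)]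
  simp

theorem ballotCoeff_pred (hp : p.Prime) {s : ℕ} (hs : s < p) (hs0 : 0 < s) :
    ballotCoeff K (p - 1) s = -2 * (-1) ^ s := by
  obtain ⟨s, rfl⟩ : ∃ t, s = t + 1 := ⟨s - 1, by omega⟩
  rw [ballotCoeff, if_neg s.succ_ne_zero, cast_choose_pred hp hs, Nat.add_sub_cancel,
    cast_choose_pred hp (by omega), pow_succ]
  ring

end BallotCoefficients

/-- The functional `x ^ i * y ^ j ↦ μ i * μ j`, normalised by having `μ` start with a `1` at
`2 * p`, kills all the forms `x ^ a * y ^ b * (x - y) * ∑ i, g i * (x + y) ^ (4 * p - 1 - i)`, where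
`g` starts with a `1` as well. -/
structure AnnihilatesForms {K : Type*} [Field K] (p : ℕ) (μ g : ℕ → K) : Prop where
  lead : μ (2 * p) = 1
  below : ∀ i < 2 * p, μ i = 0
  lead_coeff : g 0 = 1
  rel : ∀ a b, ∑ i ∈ Finset.range (4 * p), ∑ k ∈ Finset.range (4 * p + 1 - i),
    g i * ballotCoeff K (4 * p - 1 - i) k * (μ (a + k) * μ (b + (4 * p - i - k))) = 0

/-! ### Relations of a given excess -/

namespace AnnihilatesForms

variable {K : Type*} [Field K] {p : ℕ} {μ g : ℕ → K}

theorem sum_eq_zero (h : AnnihilatesForms p μ g) (a b : ℕ) (T : Finset (ℕ × ℕ))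
    (hT : ∀ x ∈ T, x.1 < 4 * p ∧ x.2 < 4 * p + 1 - x.1)
    (hz : ∀ i k, i < 4 * p → k < 4 * p + 1 - i → (i, k) ∉ T →
      g i * ballotCoeff K (4 * p - 1 - i) k * (μ (a + k) * μ (b + (4 * p - i - k))) = 0) :
    ∑ x ∈ T, g x.1 * ballotCoeff K (4 * p - 1 - x.1) x.2 *
      (μ (a + x.2) * μ (b + (4 * p - x.1 - x.2))) = 0 := by
  have hrel := h.rel a b
  rw [Finset.sum_sigma'] at hrel
  rw [← hrel]
  refine Finset.sum_subset_zero_on_sdiff (s₁ := T.map ⟨fun x => (⟨x.1, x.2⟩ : (_ : ℕ) × ℕ), ?_⟩)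
    (s₂ := (Finset.range (4 * p)).sigma fun i => Finset.range (4 * p + 1 - i))
    (f := fun x => g x.1 * ballotCoeff K (4 * p - 1 - x.1) x.2 *
      (μ (a + x.2) * μ (b + (4 * p - x.1 - x.2)))) ?_ ?_ (fun _ _ => rfl) |>.symm.trans ?_ |>.symm
  · rintro ⟨a, b⟩ ⟨c, d⟩ h
    simpa using h
  · rintro ⟨i, k⟩ hx
    obtain ⟨y, hy, hyx⟩ := Finset.mem_map.mp hx
    have h1 : y.1 = i := congrArg Sigma.fst hyx
    have h2 : y.2 = k := congrArg (fun z : (_ : ℕ) × ℕ => z.2) hyx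
    have := hT y hy
    simp only [Finset.mem_sigma, Finset.mem_range]
    omega
  · rintro ⟨i, k⟩ hx
    simp only [Finset.mem_sdiff, Finset.mem_sigma, Finset.mem_range, Finset.mem_map,
      not_exists, not_and] at hx
    exact hz i k hx.1.1 hx.1.2 fun hm => hx.2 _ hm rfl
  · rw [Finset.sum_map]
    rfl

/-- The relation of excess `j`, when everything of excess strictly between `0` and `j` vanishes. -/
theorem rel_single (h : AnnihilatesForms p μ g) {j : ℕ} (hj : 0 < j) (hjp : j < 2 * p)
    (hμ : ∀ i, 0 < i → i < j → μ (2 * p + i) = 0) (hg : ∀ i, 0 < i → i < j → g i = 0)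
    {a b : ℕ} (hab : a + b = j) :
    (ballotCoeff K (4 * p - 1) (2 * p - a) + ballotCoeff K (4 * p - 1) (2 * p + b)) * μ (2 * p + j) +
      g j * ballotCoeff K (4 * p - 1 - j) (2 * p - a) = 0 := by
  -- In each term the excesses of the two moments over `2 * p` and the index of `g` add up to `a + b
  -- = j`; one of the three must carry all of it.
  have hs := h.sum_eq_zero a b {(0, 2 * p - a), (0, 2 * p + b), (j, 2 * p - a)}
    (by simp only [Finset.mem_insert, Finset.mem_singleton]; rintro x (rfl | rfl | rfl) <;>
        constructor <;> simp only <;> omega) ?_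
  · rw [Finset.sum_insert (by simp; omega), Finset.sum_insert (by simp; omega),
      Finset.sum_singleton] at hs
    simp only [Nat.sub_zero, h.lead_coeff] at hs
    rw [show a + (2 * p - a) = 2 * p by omega, show b + (4 * p - (2 * p - a)) = 2 * p + j by omega,
      show a + (2 * p + b) = 2 * p + j by omega, show b + (4 * p - (2 * p + b)) = 2 * p by omega,
      show b + (4 * p - j - (2 * p - a)) = 2 * p by omega, h.lead] at hs
    linear_combination hs
  · intro i k hi hk hT
    simp only [Finset.mem_insert, Finset.mem_singleton, Prod.mk.injEq, not_or, not_and] at hT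
    by_cases hi0 : 0 < i ∧ i < j
    · rw [hg i hi0.1 hi0.2]; ring
    by_cases h1 : a + k < 2 * p
    · rw [h.below _ h1]; ring
    by_cases h2 : b + (4 * p - i - k) < 2 * p
    · rw [h.below _ h2]; ring
    by_cases h3 : 0 < a + k - 2 * p ∧ a + k - 2 * p < j
    · rw [show a + k = 2 * p + (a + k - 2 * p) by omega, hμ _ h3.1 h3.2]; ring
    exfalso
    by_cases h4 : i = 0
    · subst h4; omega
    · have : i = j := by omega
      subst this; omega

/-- The relation of excess `2 * j`, when everything of excess strictly between `0` and `j`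
vanishes. -/
theorem rel_double (h : AnnihilatesForms p μ g) {j : ℕ} (hj : 0 < j) (hjp : j < p)
    (hμ : ∀ i, 0 < i → i < j → μ (2 * p + i) = 0) (hg : ∀ i, 0 < i → i < j → g i = 0)
    {a b : ℕ} (hab : a + b = 2 * j) (haj : a < j) :
    (ballotCoeff K (4 * p - 1) (2 * p - a) + ballotCoeff K (4 * p - 1) (2 * p + b)) *
        μ (2 * p + 2 * j) +
      ballotCoeff K (4 * p - 1) (2 * p + (j - a)) * μ (2 * p + j) ^ 2 +
      g j * μ (2 * p + j) * (ballotCoeff K (4 * p - 1 - j) (2 * p - a) +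
        ballotCoeff K (4 * p - 1 - j) (2 * p + (j - a))) +
      g (2 * j) * ballotCoeff K (4 * p - 1 - 2 * j) (2 * p - a) = 0 := by
  -- The three excesses now add up to `2 * j`, each being `0` or at least `j`: one carries
  -- everything, or two carry `j` each.
  have hs := h.sum_eq_zero a b {(0, 2 * p - a), (0, 2 * p + b), (0, 2 * p + (j - a)),
      (j, 2 * p - a), (j, 2 * p + (j - a)), (2 * j, 2 * p - a)}
    (by simp only [Finset.mem_insert, Finset.mem_singleton]
        rintro x (rfl | rfl | rfl | rfl | rfl | rfl) <;> constructor <;> simp only <;> omega) ?_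
  · rw [Finset.sum_insert (by simp; omega), Finset.sum_insert (by simp; omega),
      Finset.sum_insert (by simp; omega), Finset.sum_insert (by simp; omega),
      Finset.sum_insert (by simp; omega), Finset.sum_singleton] at hs
    simp only [Nat.sub_zero, h.lead_coeff] at hs
    rw [show a + (2 * p - a) = 2 * p by omega,
      show b + (4 * p - (2 * p - a)) = 2 * p + 2 * j by omega,
      show a + (2 * p + b) = 2 * p + 2 * j by omega,
      show b + (4 * p - (2 * p + b)) = 2 * p by omega,
      show a + (2 * p + (j - a)) = 2 * p + j by omega,
      show b + (4 * p - (2 * p + (j - a))) = 2 * p + j by omega,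
      show b + (4 * p - j - (2 * p - a)) = 2 * p + j by omega,
      show b + (4 * p - j - (2 * p + (j - a))) = 2 * p by omega,
      show b + (4 * p - 2 * j - (2 * p - a)) = 2 * p by omega, h.lead] at hs
    linear_combination hs
  · intro i k hi hk hT
    simp only [Finset.mem_insert, Finset.mem_singleton, Prod.mk.injEq, not_or, not_and] at hT
    by_cases hi0 : 0 < i ∧ i < j
    · rw [hg i hi0.1 hi0.2]; ring
    by_cases h1 : a + k < 2 * p
    · rw [h.below _ h1]; ring
    by_cases h2 : b + (4 * p - i - k) < 2 * p
    · rw [h.below _ h2]; ring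
    by_cases h3 : 0 < a + k - 2 * p ∧ a + k - 2 * p < j
    · rw [show a + k = 2 * p + (a + k - 2 * p) by omega, hμ _ h3.1 h3.2]; ring
    by_cases h5 : 0 < b + (4 * p - i - k) - 2 * p ∧ b + (4 * p - i - k) - 2 * p < j
    · rw [show b + (4 * p - i - k) = 2 * p + (b + (4 * p - i - k) - 2 * p) by omega,
        hμ _ h5.1 h5.2]; ring
    exfalso
    by_cases h4 : i = 0
    · subst h4; omega
    · by_cases h6 : i = j
      · subst h6; omega
      · have : i = 2 * j := by omega
        subst this; omega

end AnnihilatesForms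

/-! ### Ballot coefficients near the middle -/

section BallotCoefficients

variable {K : Type*} [Field K] {p : ℕ} [CharP K p]

theorem natCast_ne_zero_of_lt {n : ℕ} (h0 : 0 < n) (hn : n < p) : (n : K) ≠ 0 := by
  rw [Ne, CharP.cast_eq_zero_iff K p]
  exact Nat.not_dvd_of_pos_of_lt h0 hn

theorem ballotCoeff_middle_add (hp : p.Prime) {s : ℕ} (hs0 : 0 < s) (hs : s < p) :
    ballotCoeff K (4 * p - 1) (2 * p + s) = -6 * (-1) ^ s := by
  have := hp.one_le
  rw [show 4 * p - 1 = 3 * p + (p - 1) by omega, ballotCoeff_add_mul hp (by omega) hs hs0,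
    ballotCoeff_pred hp hs hs0, show Nat.choose 3 2 = 3 from rfl]
  push_cast; ring

theorem ballotCoeff_middle_sub (hp : p.Prime) (hodd : Odd p) {s : ℕ} (hs0 : 0 < s) (hs : s < p) :
    ballotCoeff K (4 * p - 1) (2 * p - s) = 6 * (-1) ^ s := by
  have := hp.one_le
  rw [show 4 * p - 1 = 3 * p + (p - 1) by omega, show 2 * p - s = 1 * p + (p - s) by omega,
    ballotCoeff_add_mul hp (by omega) (by omega) (by omega),
    ballotCoeff_pred hp (by omega) (by omega), Nat.choose_one_right]
  have h : (-1 : K) ^ (p - s) = -(-1) ^ s := by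
    have h1 : (-1 : K) ^ (p - s) * (-1) ^ s = -1 := by
      rw [← pow_add, Nat.sub_add_cancel hs.le, hodd.neg_one_pow]
    have h2 : (-1 : K) ^ s * (-1) ^ s = 1 := by rw [← mul_pow]; simp
    linear_combination (-1 : K) ^ s * h1 - (-1 : K) ^ (p - s) * h2
  rw [h]; push_cast; ring

theorem ballotCoeff_middle (hp : p.Prime) :
    ballotCoeff K (4 * p - 1) (2 * p) = 0 := by
  have := hp.one_le
  rw [show 4 * p - 1 = 3 * p + (p - 1) by omega, show 2 * p = (1 + 1) * p by omega,
    ballotCoeff_add_mul_self hp (by omega), Nat.choose_self]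
  norm_num [Nat.choose]

theorem ballotCoeff_shift_middle (hp : p.Prime) {j : ℕ} (hj0 : 0 < j) (hj : j < p) :
    ballotCoeff K (4 * p - 1 - j) (2 * p) = -3 := by
  rw [show 4 * p - 1 - j = 3 * p + (p - 1 - j) by omega, show 2 * p = (1 + 1) * p by omega,
    ballotCoeff_add_mul_self hp (by omega), Nat.choose_eq_zero_of_lt (by omega : p - 1 - j < p - 1)]
  norm_num [Nat.choose]

/-- The lower digits are `p - 1 - j` and `p - s`. For `s < j` the latter is too large by at least
two; `s = j` would give the extreme coefficient `1` instead. -/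
theorem ballotCoeff_shift_middle_sub (hp : p.Prime) {j s : ℕ} (hs0 : 0 < s) (hs : s < j)
    (hj : j < p) : ballotCoeff K (4 * p - 1 - j) (2 * p - s) = 0 := by
  rw [show 4 * p - 1 - j = 3 * p + (p - 1 - j) by omega,
    show 2 * p - s = 1 * p + (p - s) by omega,
    ballotCoeff_add_mul hp (by omega) (by omega) (by omega), ballotCoeff_of_lt (by omega), mul_zero]

theorem ballotCoeff_shift_middle_add (hp : p.Prime) {j s : ℕ} (hs0 : 0 < s) (hs : s < p)
    (hj : j < p) : ballotCoeff K (4 * p - 1 - j) (2 * p + s) = 3 * ballotCoeff K (p - 1 - j) s := by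
  rw [show 4 * p - 1 - j = 3 * p + (p - 1 - j) by omega,
    ballotCoeff_add_mul hp (by omega) (by omega) (by omega), show Nat.choose 3 2 = 3 from rfl]
  norm_num

theorem ballotCoeff_shift_long_middle_sub (hp : p.Prime) {n s : ℕ} (hs0 : 0 < s) (hs : s < p)
    (hn : p ≤ n) (hn2 : n < 2 * p) :
    ballotCoeff K (4 * p - 1 - n) (2 * p - s) = 2 * ballotCoeff K (2 * p - 1 - n) (p - s) := by
  rw [show 4 * p - 1 - n = 2 * p + (2 * p - 1 - n) by omega,
    show 2 * p - s = 1 * p + (p - s) by omega,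
    ballotCoeff_add_mul hp (by omega) (by omega) (by omega), Nat.choose_one_right]
  norm_num

theorem cast_choose_two_mul_two (n : ℕ) : (n.choose 2 : K) * 2 = n * (n - 1) := by
  cases n with
  | zero => simp
  | succ n =>
    have h : (n + 1).choose 2 * 2 = (n + 1) * n := by
      rw [Nat.choose_two_right, Nat.add_sub_cancel, Nat.div_mul_cancel]
      rw [mul_comm]; exact (Nat.even_mul_succ_self n).two_dvd
    have h' := congrArg (Nat.cast (R := K)) h
    push_cast at h' ⊢
    linear_combination h'

theorem ballotCoeff_self {M : ℕ} (hM : 0 < M) : ballotCoeff K M M = M - 1 := by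
  rw [ballotCoeff, if_neg (by omega), Nat.choose_self, Nat.choose_symm hM, Nat.choose_one_right,
    Nat.cast_one]

theorem ballotCoeff_sub_one_mul_two {M : ℕ} (hM : 2 ≤ M) :
    ballotCoeff K M (M - 1) * 2 = M * (M - 1) - 2 * M := by
  rw [ballotCoeff, if_neg (by omega), Nat.choose_symm (by omega), Nat.choose_one_right,
    show M - 1 - 1 = M - 2 by omega, Nat.choose_symm hM, sub_mul, cast_choose_two_mul_two]
  ring

theorem ballotCoeff_one (M : ℕ) : ballotCoeff K M 1 = 1 - M := by
  simp [ballotCoeff]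

end BallotCoefficients

/-! ### The induction killing the moments -/

namespace AnnihilatesForms

variable {K : Type*} [Field K] {p : ℕ} {μ g : ℕ → K} [CharP K p]

/-- The functional vanishes at the `p - 2` positions above the leading one as soon as it vanishes
at the first of them. -/
theorem eq_zero (h : AnnihilatesForms p μ g) (hp : p.Prime) (hp5 : 5 ≤ p) (h1 : μ (2 * p + 1) = 0)
    {j : ℕ} (hj0 : 0 < j) (hj : j + 2 ≤ p) : μ (2 * p + j) = 0 := by
  have hodd : Odd p := hp.odd_of_ne_two (by omega)
  have c2 : (2 : K) ≠ 0 := by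
    exact_mod_cast natCast_ne_zero_of_lt (K := K) (p := p) two_pos (by omega)
  have c3 : (3 : K) ≠ 0 := by
    exact_mod_cast natCast_ne_zero_of_lt (K := K) (p := p) three_pos (by omega)
  suffices H : μ (2 * p + j) = 0 ∧ g j = 0 from H.1
  induction j using Nat.strong_induction_on with
  | _ j ih =>
  have hμ : ∀ i, 0 < i → i < j → μ (2 * p + i) = 0 := fun i hi hij => (ih i hij hi (by omega)).1
  have hg : ∀ i, 0 < i → i < j → g i = 0 := fun i hi hij => (ih i hij hi (by omega)).2
  -- With `a = 0` the relation expresses `g j` through the moment, so only the moment remains to be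
  -- killed.
  have hgj := h.rel_single hj0 (by omega) hμ hg (zero_add j)
  rw [Nat.sub_zero, ballotCoeff_middle hp, ballotCoeff_middle_add hp hj0 (by omega),
    ballotCoeff_shift_middle hp hj0 (by omega)] at hgj
  have hgj' : g j = -2 * (-1) ^ j * μ (2 * p + j) :=
    mul_left_cancel₀ c3 (by linear_combination -hgj)
  suffices H : μ (2 * p + j) = 0 by exact ⟨H, by rw [hgj', H, mul_zero]⟩
  -- For even `j` the other linear relations cancel by parity, so excess `2 * j` is used to kill the
  -- square of the moment.
  rcases Nat.even_or_odd j with hev | hod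
  · rw [hev.neg_one_pow] at hgj'
    have hj2 : 2 ≤ j := by obtain ⟨k, rfl⟩ := hev; omega
    have hjp3 : j + 3 ≤ p := by
      obtain ⟨k, rfl⟩ := hev
      obtain ⟨l, hl⟩ := hodd
      omega
    suffices H : μ (2 * p + j) ^ 2 = 0 from pow_eq_zero_iff two_ne_zero |>.mp H
    set Y := μ (2 * p + j) ^ 2 with hY
    have hgY : g j * μ (2 * p + j) = -2 * Y := by rw [hgj', hY]; ring
    rcases Nat.lt_or_ge (2 * j) p with hlt | hge
    · have hr := h.rel_double hj0 (by omega) hμ hg (a := j - 1) (b := j + 1) (by omega) (by omega)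
      have hpar : (-1 : K) ^ (j - 1) = (-1) ^ (j + 1) := by
        rw [show j + 1 = j - 1 + 2 by omega, pow_add]; simp
      rw [ballotCoeff_middle_sub hp hodd (by omega) (by omega),
        ballotCoeff_middle_add hp (by omega) (by omega), show j - (j - 1) = 1 by omega,
        ballotCoeff_middle_add hp (by omega) (by omega),
        ballotCoeff_shift_middle_sub hp (by omega) (by omega) (by omega),
        ballotCoeff_shift_middle_add hp (by omega) (by omega) (by omega), ballotCoeff_one,
        ballotCoeff_shift_middle_sub hp (by omega) (by omega) (by omega), hpar, hgY, ← hY] at hr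
      have hM := natCast_ne_zero_of_lt (K := K) (p := p) (n := p - 1 - j) (by omega) (by omega)
      have : (2 * 3 * (p - 1 - j : ℕ) : K) * Y = 0 := by linear_combination hr
      exact (mul_eq_zero.mp this).resolve_left (mul_ne_zero (mul_ne_zero c2 c3) hM)
    · have hne : p ≠ 2 * j := fun e => (Nat.not_even_iff_odd.mpr hodd) ⟨j, by omega⟩
      obtain ⟨M, hM⟩ : ∃ M, M = p - 1 - j := ⟨_, rfl⟩
      have hMev : Even M := by
        obtain ⟨k, rfl⟩ := hev
        obtain ⟨l, hl⟩ := hodd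
        exact ⟨l - k, by omega⟩
      -- Here `g (2 * j)` survives, so two relations are needed to eliminate it. The largest `b`
      -- below `p` put the ballot coefficients at the easily evaluated end of their range.
      have hr1 := h.rel_double hj0 (by omega) hμ hg (a := 2 * j - (p - 1)) (b := p - 1) (by omega)
        (by omega)
      have hr2 := h.rel_double hj0 (by omega) hμ hg (a := 2 * j - (p - 2)) (b := p - 2) (by omega)
        (by omega)
      have hpar1 : (-1 : K) ^ (2 * j - (p - 1)) = (-1) ^ (p - 1) := by
        obtain ⟨l, hl⟩ := hodd
        rw [Even.neg_one_pow ⟨j - l, by omega⟩, Even.neg_one_pow ⟨l, by omega⟩]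
      have hpar2 : (-1 : K) ^ (2 * j - (p - 2)) = (-1) ^ (p - 2) := by
        obtain ⟨l, hl⟩ := hodd
        rw [Odd.neg_one_pow ⟨j - l, by omega⟩, Odd.neg_one_pow ⟨l - 1, by omega⟩]
      have hMpar : (-1 : K) ^ (M - 1) = -1 := by
        obtain ⟨l, hl⟩ := hMev
        exact Odd.neg_one_pow ⟨l - 1, by omega⟩
      rw [ballotCoeff_middle_sub hp hodd (by omega) (by omega),
        ballotCoeff_middle_add hp (by omega) (by omega),
        show j - (2 * j - (p - 1)) = M by omega,
        ballotCoeff_middle_add hp (by omega) (by omega),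
        ballotCoeff_shift_middle_sub hp (by omega) (by omega) (by omega),
        ballotCoeff_shift_middle_add hp (by omega) (by omega) (by omega),
        ballotCoeff_shift_long_middle_sub hp (by omega) (by omega) (by omega) (by omega), hgY, hpar1,
        ← hM, ballotCoeff_self (by omega), show p - (2 * j - (p - 1)) = 2 * M + 1 by omega,
        show 2 * p - 1 - 2 * j = 2 * M + 1 by omega, ballotCoeff_self (by omega),
        hMev.neg_one_pow, ← hY] at hr1
      rw [ballotCoeff_middle_sub hp hodd (by omega) (by omega),
        ballotCoeff_middle_add hp (by omega) (by omega),
        show j - (2 * j - (p - 2)) = M - 1 by omega,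
        ballotCoeff_middle_add hp (by omega) (by omega),
        ballotCoeff_shift_middle_sub hp (by omega) (by omega) (by omega),
        ballotCoeff_shift_middle_add hp (by omega) (by omega) (by omega),
        ballotCoeff_shift_long_middle_sub hp (by omega) (by omega) (by omega) (by omega), hgY, hpar2,
        ← hM, show p - (2 * j - (p - 2)) = 2 * M + 1 - 1 by omega,
        show 2 * p - 1 - 2 * j = 2 * M + 1 by omega, hMpar, ← hY] at hr2
      have e1 := ballotCoeff_sub_one_mul_two (K := K) (M := M) (by omega)
      have e2 := ballotCoeff_sub_one_mul_two (K := K) (M := 2 * M + 1) (by omega)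
      push_cast at hr1 hr2 e1 e2
      have hM0 := natCast_ne_zero_of_lt (K := K) (p := p) (n := M) (by omega) (by omega)
      have hM1 := natCast_ne_zero_of_lt (K := K) (p := p) (n := M + 1) (by omega) (by omega)
      have hgn : 2 * g (2 * j) = 3 * Y :=
        mul_left_cancel₀ (mul_ne_zero c2 hM0) (by linear_combination hr1)
      have : (3 * (M + 1 : ℕ) ^ 2 : K) * Y = 0 := by
        push_cast
        apply mul_left_cancel₀ c2
        linear_combination 2 * hr2 + 6 * Y * e1 - 2 * g (2 * j) * e2 -
          (2 * M + 1) * (2 * M - 2) * hgn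
      exact (mul_eq_zero.mp this).resolve_left (mul_ne_zero c3 (pow_ne_zero 2 hM1))
  -- For odd `j ≥ 3`, taking `a = 1` makes the two signs agree; `j = 1` leaves no room for this and
  -- is the hypothesis `h1`.
  · rcases Nat.lt_or_ge j 3 with hlt | hge
    · obtain rfl : j = 1 := by obtain ⟨k, rfl⟩ := hod; omega
      exact h1
    · have hr := h.rel_single hj0 (by omega) hμ hg (a := 1) (b := j - 1) (by omega)
      have hpar : (-1 : K) ^ (j - 1) = 1 := by
        obtain ⟨k, rfl⟩ := hod
        simp [pow_mul]
      rw [ballotCoeff_middle_sub hp hodd (by omega) (by omega),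
        ballotCoeff_middle_add hp (by omega) (by omega),
        ballotCoeff_shift_middle_sub hp (by omega) (by omega) (by omega), hpar] at hr
      have : (2 * 2 * 3 : K) * μ (2 * p + j) = 0 := by linear_combination -hr
      exact (mul_eq_zero.mp this).resolve_left (mul_ne_zero (mul_ne_zero c2 c2) c3)

end AnnihilatesForms

/-! ### From restricted sums to power sums -/

open Polynomial in
/-- A set of `2 * p + 1` elements with sum zero in a field of characteristic `p` having fewer than
`4 * p` restricted sums has vanishing power sums of exponents `1, …, p - 2`. -/
theorem sum_pow_eq_zero_of_card_restrictedSumset_lt {K : Type*} [Field K] [DecidableEq K] {p : ℕ}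
    [CharP K p] (hp : p.Prime) (hp5 : 5 ≤ p) {S : Finset K} (hS : S.card = 2 * p + 1)
    (h0 : ∑ s ∈ S, s = 0) (hlt : (restrictedSumset S S).card < 4 * p) {j : ℕ} (hj0 : 0 < j)
    (hj : j + 2 ≤ p) : ∑ s ∈ S, s ^ j = 0 := by
  set R := restrictedSumset S S with hR
  -- Padding by a power of `X` gives `(x - y) * P (x + y)` the degree `4 * p = 2 * (#S - 1)`,
  -- critical in both variables.
  set P : K[X] := (∏ c ∈ R, (X - C c)) * X ^ (4 * p - 1 - R.card) with hPdef
  have hmon : (∏ c ∈ R, (X - C c)).Monic := monic_prod_of_monic _ _ fun c _ => monic_X_sub_C c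
  have hPmon : P.Monic := hmon.mul (monic_X_pow _)
  have hPdeg : P.natDegree = 4 * p - 1 := by
    rw [hPdef, hmon.natDegree_mul (monic_X_pow _), natDegree_X_pow,
      natDegree_prod_of_monic _ _ fun c _ => monic_X_sub_C c]
    simp only [natDegree_X_sub_C, Finset.sum_const, smul_eq_mul, mul_one]
    omega
  have hPz : ∀ s ∈ S, ∀ t ∈ S, s ≠ t → P.eval (s + t) = 0 := by
    intro s hs t ht hst
    rw [hPdef, eval_mul, eval_prod, Finset.prod_eq_zero
      (mem_restrictedSumset.mpr ⟨s, hs, t, ht, hst, rfl⟩) (by simp), zero_mul]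
  have hform : AnnihilatesForms p (weightedPowerSum S) (fun i => P.coeff (4 * p - 1 - i)) := by
    refine ⟨weightedPowerSum_pred (by omega), fun i hi => weightedPowerSum_of_lt (by omega), ?_,
      fun a b => ?_⟩
    · rw [Nat.sub_zero, ← hPdeg]
      exact hPmon
    · rw [← sum_coeff_mul_ballotCoeff P hPz (d := 4 * p) (by omega) a b,
        ← Finset.sum_range_reflect]
      refine Finset.sum_congr rfl fun N hN => ?_
      rw [Finset.mem_range] at hN
      rw [show 4 * p - 1 - (4 * p - 1 - N) = N by omega,
        show 4 * p + 1 - (4 * p - 1 - N) = N + 2 by omega,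
        show 4 * p - (4 * p - 1 - N) = N + 1 by omega]
  have hne : S.Nonempty := by rw [← Finset.card_pos]; omega
  have h1 : weightedPowerSum S (2 * p + 1) = 0 := by
    rw [← hS, weightedPowerSum_card hne, h0]
  refine sum_pow_eq_zero (m := p - 2) (fun l hl hlm => ?_) hj0 (by omega) (by omega)
  rw [hS, Nat.add_sub_cancel]
  exact hform.eq_zero hp hp5 h1 hl (by omega)

theorem card_restrictedSumset_image {G H : Type*} [AddCommGroup G] [AddCommGroup H] [DecidableEq G]
    [DecidableEq H] (f : G →+ H) (hf : Function.Injective f) (A : Finset G) :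
    (restrictedSumset (A.image f) (A.image f)).card = (restrictedSumset A A).card := by
  rw [← Finset.card_image_of_injective _ hf]
  congr 1
  ext x
  simp only [mem_restrictedSumset, Finset.mem_image]
  constructor
  · rintro ⟨_, ⟨a, ha, rfl⟩, _, ⟨b, hb, rfl⟩, hab, rfl⟩
    exact ⟨a + b, ⟨a, ha, b, hb, fun h => hab (h ▸ rfl), rfl⟩, map_add f a b⟩
  · rintro ⟨_, ⟨a, ha, b, hb, hab, rfl⟩, rfl⟩
    exact ⟨f a, ⟨a, ha, rfl⟩, f b, ⟨b, hb, rfl⟩, fun h => hab (hf h), (map_add f a b).symm⟩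

theorem card_restrictedSumset_image_add {G : Type*} [AddCommGroup G] [DecidableEq G]
    (A : Finset G) (c : G) :
    (restrictedSumset (A.image (· + c)) (A.image (· + c))).card = (restrictedSumset A A).card := by
  rw [← Finset.card_image_of_injective (restrictedSumset A A) (add_left_injective (c + c))]
  congr 1
  ext x
  simp only [mem_restrictedSumset, Finset.mem_image]
  constructor
  · rintro ⟨_, ⟨a, ha, rfl⟩, _, ⟨b, hb, rfl⟩, hab, rfl⟩
    exact ⟨a + b, ⟨a, ha, b, hb, fun h => hab (h ▸ rfl), rfl⟩, by abel⟩
  · rintro ⟨_, ⟨a, ha, b, hb, hab, rfl⟩, rfl⟩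
    exact ⟨a + c, ⟨a, ha, rfl⟩, b + c, ⟨b, hb, rfl⟩, fun h => hab (add_right_cancel h), by abel⟩

/-! ### Linear forms on the plane and their fibres -/

section Plane

variable {p : ℕ} [Fact p.Prime]

/-- The linear form `(u, v) ↦ u + v * t`. -/
def affineSlope (t : ZMod p) : ZMod p × ZMod p →+ ZMod p :=
  (AddMonoidHom.fst _ _) + (AddMonoidHom.mulRight t).comp (AddMonoidHom.snd _ _)

@[simp]
theorem affineSlope_apply (t : ZMod p) (x : ZMod p × ZMod p) : affineSlope t x = x.1 + x.2 * t :=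
  rfl

-- A single form is not injective on the plane, but the generic one `u + v * X` is; the identity
-- obtained for it lives in the polynomial ring and can be evaluated at `t`.
open Polynomial in
theorem sum_affineSlope_pow_eq_zero (hp5 : 5 ≤ p) {A : Finset (ZMod p × ZMod p)}
    (hA : A.card = 2 * p + 1) (h0 : ∑ a ∈ A, a = 0) (hlt : (restrictedSumset A A).card < 4 * p)
    (t : ZMod p) {j : ℕ} (hj0 : 0 < j) (hj : j + 2 ≤ p) : ∑ a ∈ A, affineSlope t a ^ j = 0 := by
  classical
  have hp : p.Prime := Fact.out
  let L := FractionRing (ZMod p)[X]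
  have hinj : Function.Injective (algebraMap (ZMod p)[X] L) := IsFractionRing.injective _ _
  have : CharP L p := charP_of_injective_algebraMap hinj p
  let φ : ZMod p × ZMod p →+ (ZMod p)[X] :=
    (C : ZMod p →+* (ZMod p)[X]).toAddMonoidHom.comp (AddMonoidHom.fst _ _) +
      (AddMonoidHom.mulLeft X).comp
        ((C : ZMod p →+* (ZMod p)[X]).toAddMonoidHom.comp (AddMonoidHom.snd _ _))
  have hφ : ∀ x, φ x = C x.1 + X * C x.2 := fun x => rfl
  have hφinj : Function.Injective φ := by
    intro x y hxy
    rw [hφ, hφ] at hxy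
    have e0 := congrArg (fun P => coeff P 0) hxy
    have e1 := congrArg (fun P => coeff P 1) hxy
    simp [coeff_C] at e0 e1
    exact Prod.ext e0 e1
  let ψ : ZMod p × ZMod p →+ L := (algebraMap (ZMod p)[X] L).toAddMonoidHom.comp φ
  have hψ : ∀ x, ψ x = algebraMap (ZMod p)[X] L (φ x) := fun x => rfl
  have hψinj : Function.Injective ψ := hinj.comp hφinj
  have key := sum_pow_eq_zero_of_card_restrictedSumset_lt (K := L) hp hp5 (S := A.image ψ)
    (by rw [Finset.card_image_of_injective _ hψinj, hA])
    (by rw [Finset.sum_image hψinj.injOn, ← map_sum, h0, map_zero])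
    (by rwa [card_restrictedSumset_image ψ hψinj]) hj0 hj
  rw [Finset.sum_image hψinj.injOn] at key
  simp only [hψ, ← map_pow, ← map_sum] at key
  rw [map_eq_zero_iff _ hinj] at key
  have := congrArg (eval t) key
  simpa [eval_finsetSum, hφ] using this

/-- The fibres of a linear form with vanishing power sums have constant size modulo `p`, except for
the fibre over zero. -/
theorem natCast_card_fiber {ι : Type*} (hp5 : 5 ≤ p) {A : Finset ι} (hA : A.card = 2 * p + 1)
    (f : ι → ZMod p) (hf : ∀ j, 0 < j → j + 2 ≤ p → ∑ a ∈ A, f a ^ j = 0) (s : ZMod p) :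
    ((A.filter fun a => f a = s).card : ZMod p) =
      -(∑ a ∈ A, f a ^ (p - 1)) + if s = 0 then 1 else 0 := by
  classical
  have hind : ∀ x : ZMod p, (if x = 0 then (1 : ZMod p) else 0) = 1 - x ^ (p - 1) := by
    intro x
    split_ifs with h
    · rw [h, zero_pow (by omega), sub_zero]
    · rw [ZMod.pow_card_sub_one_eq_one h, sub_self]
  -- Only the two extreme terms of the binomial expansion survive, and `#A = 1` in `ZMod p`.
  have hexp : ∑ a ∈ A, (f a - s) ^ (p - 1) =
      s ^ (p - 1) + ∑ a ∈ A, f a ^ (p - 1) := by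
    simp_rw [sub_eq_add_neg, add_pow]
    rw [Finset.sum_comm, Finset.sum_range_succ, show p - 1 = (p - 2) + 1 by omega,
      Finset.sum_range_succ']
    have hz : ∑ k ∈ Finset.range (p - 2), ∑ a ∈ A, f a ^ (k + 1) *
        (-s) ^ (p - 2 + 1 - (k + 1)) * ((p - 2 + 1).choose (k + 1) : ZMod p) = 0 := by
      refine Finset.sum_eq_zero fun k hk => ?_
      rw [Finset.mem_range] at hk
      rw [← Finset.sum_mul, ← Finset.sum_mul, hf (k + 1) k.succ_pos (by omega), zero_mul, zero_mul]
    rw [hz]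
    have hodd : Odd p := (Fact.out : p.Prime).odd_of_ne_two (by omega)
    have hev : Even (p - 2 + 1) := by
      obtain ⟨l, hl⟩ := hodd
      exact ⟨l, by omega⟩
    simp [hA, hev.neg_pow]
  rw [Finset.card_filter, Nat.cast_sum]
  simp_rw [Nat.cast_ite, Nat.cast_one, Nat.cast_zero]
  have : ∀ a, (if f a = s then (1 : ZMod p) else 0) = 1 - (f a - s) ^ (p - 1) := fun a => by
    rw [← hind]; simp [sub_eq_zero]
  simp_rw [this, hind]
  rw [Finset.sum_sub_distrib, hexp]
  simp [hA]
  ring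

end Plane

/-! ### Lines through the origin and the lower bound -/

section Plane

variable {p : ℕ} [Fact p.Prime]

theorem card_fiber_of_surjective (f : ZMod p × ZMod p →+ ZMod p) (hf : Function.Surjective f)
    (s : ZMod p) : (Finset.univ.filter fun x => f x = s).card = p := by
  have hconst : ∀ t : ZMod p, (Finset.univ.filter fun x => f x = t).card =
      (Finset.univ.filter fun x => f x = s).card := by
    intro t
    obtain ⟨y, hy⟩ := hf (s - t)
    refine Finset.card_bij (fun x _ => x + y) (fun x hx => ?_) (fun x _ z _ h => add_right_cancel h)
      (fun x hx => ⟨x - y, ?_, sub_add_cancel x y⟩)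
    · simp only [Finset.mem_filter, Finset.mem_univ, true_and] at hx ⊢
      rw [map_add, hx, hy]; abel
    · simp only [Finset.mem_filter, Finset.mem_univ, true_and] at hx ⊢
      rw [map_sub, hx, hy]; abel
  have h := Finset.card_eq_sum_card_fiberwise (f := f) (s := Finset.univ) (t := Finset.univ)
    (fun _ _ => Finset.mem_coe.mpr (Finset.mem_univ _))
  rw [Finset.sum_congr rfl fun t _ => hconst t, Finset.sum_const, Finset.card_univ,
    Finset.card_univ, Fintype.card_prod, ZMod.card, smul_eq_mul] at h
  exact (Nat.eq_of_mul_eq_mul_left (Fact.out : p.Prime).pos h).symm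

/-- A set containing two parallel lines avoiding the origin and a point on the line through the
origin parallel to them has at least `4 * p` restricted sums. -/
theorem le_card_restrictedSumset_of_fibers (hp5 : 5 ≤ p) (f : ZMod p × ZMod p →+ ZMod p)
    (hf : Function.Surjective f) {A : Finset (ZMod p × ZMod p)} {s t : ZMod p} (hst : s ≠ t)
    (hs0 : s ≠ 0) (ht0 : t ≠ 0) (hs : ∀ x, f x = s → x ∈ A) (ht : ∀ x, f x = t → x ∈ A)
    {z : ZMod p × ZMod p} (hz : z ∈ A) (hfz : f z = 0) :
    4 * p ≤ (restrictedSumset A A).card := by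
  have c2 : (2 : ZMod p) ≠ 0 := by
    exact_mod_cast natCast_ne_zero_of_lt (K := ZMod p) (p := p) two_pos (by omega)
  have c3 : (3 : ZMod p) ≠ 0 := by
    exact_mod_cast natCast_ne_zero_of_lt (K := ZMod p) (p := p) three_pos (by omega)
  have hdouble : ∀ r, (∀ x, f x = r → x ∈ A) → ∀ x, f x = 2 * r → x ∈ restrictedSumset A A := by
    intro r hr x hx
    obtain ⟨y, hy⟩ := hf r
    obtain ⟨k, hk0, hk⟩ : ∃ k, k ≠ 0 ∧ f k = 0 := by
      have hcard := card_fiber_of_surjective f hf 0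
      obtain ⟨k, hk, hne⟩ := Finset.exists_mem_ne (by rw [hcard]; omega) (0 : ZMod p × ZMod p)
      exact ⟨k, hne, (Finset.mem_filter.mp hk).2⟩
    have hmem : ∀ y, f y = r → y ≠ x - y → x ∈ restrictedSumset A A := fun y hy hne =>
      mem_restrictedSumset.mpr ⟨y, hr y hy, x - y, hr _ (by rw [map_sub, hx, hy]; ring), hne,
        add_sub_cancel _ _⟩
    -- If `x` is twice `y`, moving `y` along the kernel makes the summands distinct.
    by_cases hyx : y = x - y
    · refine hmem (y + k) (by rw [map_add, hy, hk, add_zero]) fun h => hk0 ?_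
      have h2 : k + k = 0 := by
        have hxy : x = y + y := (sub_eq_iff_eq_add.mp hyx.symm)
        rw [hxy] at h
        calc k + k = (y + k) - (y + y - (y + k)) := by abel
          _ = 0 := sub_eq_zero.mpr h
      have h3 : (2 : ZMod p) * k.1 = 0 := by rw [two_mul]; exact congrArg Prod.fst h2
      have h4 : (2 : ZMod p) * k.2 = 0 := by rw [two_mul]; exact congrArg Prod.snd h2
      exact Prod.ext ((mul_eq_zero.mp h3).resolve_left c2) ((mul_eq_zero.mp h4).resolve_left c2)
    · exact hmem y hy hyx
  have hsum : ∀ x, f x = s + t → x ∈ restrictedSumset A A := by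
    intro x hx
    obtain ⟨y, hy⟩ := hf s
    have hxy : f (x - y) = t := by rw [map_sub, hx, hy]; ring
    exact mem_restrictedSumset.mpr ⟨y, hs y hy, x - y, ht _ hxy,
      fun h => hst (by rw [← hy, ← hxy, ← h]), add_sub_cancel _ _⟩
  have hpoint : ∀ r, r ≠ 0 → (∀ x, f x = r → x ∈ A) → ∀ x, f x = r → x ∈ restrictedSumset A A := by
    intro r hr0 hr x hx
    have hxz : f (x - z) = r := by rw [map_sub, hx, hfz, sub_zero]
    exact mem_restrictedSumset.mpr ⟨z, hz, x - z, hr _ hxz,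
      fun h => hr0 (by rw [← hxz, ← h, hfz]), add_sub_cancel _ _⟩
  obtain ⟨V, hV, hVA⟩ : ∃ V : Finset (ZMod p), V.card = 4 ∧
      ∀ x, f x ∈ V → x ∈ restrictedSumset A A := by
    have h1 : 2 * s ≠ s + t := fun h => hst (by linear_combination h)
    have h2 : 2 * s ≠ 2 * t := fun h => hst (mul_left_cancel₀ c2 h)
    have h3 : s + t ≠ 2 * t := fun h => hst (by linear_combination h)
    -- The fourth value is `s`, unless `s = 2 * t`; then it is `t`, since `t = 2 * s` as well would
    -- give `3 * t = 0`.
    by_cases h : s = 2 * t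
    · refine ⟨{t, 2 * s, s + t, 2 * t}, ?_, ?_⟩
      · have h4 : t ≠ 2 * s := fun e => mul_ne_zero c3 ht0 (by linear_combination -e - 2 * h)
        have h5 : t ≠ s + t := fun e => hs0 (by linear_combination -e)
        have h6 : t ≠ 2 * t := fun e => ht0 (by linear_combination -e)
        simp [h1, h2, h3, h4, h5, h6, -mul_eq_mul_left_iff, -right_eq_add]
      · intro x hx
        simp only [Finset.mem_insert, Finset.mem_singleton] at hx
        rcases hx with hx | hx | hx | hx
        exacts [hpoint t ht0 ht x hx, hdouble s hs x hx, hsum x hx, hdouble t ht x hx]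
    · refine ⟨{s, 2 * s, s + t, 2 * t}, ?_, ?_⟩
      · have h5 : s ≠ s + t := fun e => ht0 (by linear_combination -e)
        have h6 : s ≠ 2 * s := fun e => hs0 (by linear_combination -e)
        simp [h, h1, h2, h3, h5, h6, -mul_eq_mul_left_iff, -left_eq_add]
      · intro x hx
        simp only [Finset.mem_insert, Finset.mem_singleton] at hx
        rcases hx with hx | hx | hx | hx
        exacts [hpoint s hs0 hs x hx, hdouble s hs x hx, hsum x hx, hdouble t ht x hx]
  calc 4 * p = ∑ r ∈ V, ((Finset.univ.filter fun x => f x ∈ V).filter fun x => f x = r).card := by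
        rw [Finset.sum_congr rfl fun r hr => ?_, Finset.sum_const, hV, smul_eq_mul]
        rw [Finset.filter_filter]
        refine Eq.trans (congrArg Finset.card ?_) (card_fiber_of_surjective f hf r)
        ext x
        simp only [Finset.mem_filter, Finset.mem_univ, true_and]
        exact ⟨fun h => h.2, fun h => ⟨h ▸ hr, h⟩⟩
    _ = (Finset.univ.filter fun x => f x ∈ V).card :=
        (Finset.card_eq_sum_card_fiberwise fun x hx => by simpa using hx).symm
    _ ≤ _ := Finset.card_le_card fun x hx => hVA x (Finset.mem_filter.mp hx).2

/-- If a linear form has vanishing power sums on a set of `2 * p + 1` points with fewer than `4 * p`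
restricted sums, its kernel meets the set in three points. -/
theorem card_filter_eq_three (hp5 : 5 ≤ p) {A : Finset (ZMod p × ZMod p)}
    (hA : A.card = 2 * p + 1) (hlt : (restrictedSumset A A).card < 4 * p)
    (f : ZMod p × ZMod p →+ ZMod p) (hsurj : Function.Surjective f)
    (hf : ∀ j, 0 < j → j + 2 ≤ p → ∑ a ∈ A, f a ^ j = 0) :
    (A.filter fun a => f a = 0).card = 3 := by
  have hp : p.Prime := Fact.out
  set N : ZMod p → ℕ := fun s => (A.filter fun a => f a = s).card with hN
  have hfib := natCast_card_fiber hp5 hA f hf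
  set c : ZMod p := -(∑ a ∈ A, f a ^ (p - 1)) with hc
  have hsub : ∀ s, (A.filter fun a => f a = s) ⊆ Finset.univ.filter fun x => f x = s := fun s =>
    Finset.filter_subset_filter _ (Finset.subset_univ A)
  have hle : ∀ s, N s ≤ p := fun s =>
    (Finset.card_le_card (hsub s)).trans (card_fiber_of_surjective f hsurj s).le
  have hmod : ∀ s, s ≠ 0 → N s % p = c.val := by
    intro s hs
    have := hfib s
    rw [if_neg hs, add_zero] at this
    rw [← this, ZMod.val_natCast]
  have hmod0 : N 0 % p = (c.val + 1) % p := by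
    have := hfib 0
    rw [if_pos rfl] at this
    rw [← ZMod.val_natCast, this, ZMod.val_add, ZMod.val_one'' (by omega)]
  have hcp : c.val < p := ZMod.val_lt c
  have htot : N 0 + ∑ s ∈ Finset.univ.erase 0, N s = 2 * p + 1 := by
    rw [Finset.add_sum_erase _ _ (Finset.mem_univ 0), ← hA]
    exact (Finset.card_eq_sum_card_fiberwise fun _ _ => Finset.mem_coe.mpr (Finset.mem_univ _)).symm
  have hle0 := hle 0
  -- If the common residue is zero, nonzero fibres are empty or full, and exactly two are full.
  -- Otherwise all of them have size `c.val`; the total leaves only `1` and `2`, and `1` would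
  -- overfill the kernel.
  rcases Nat.eq_zero_or_pos c.val with h0 | h0
  · exfalso
    have hval : ∀ s, s ≠ 0 → N s = 0 ∨ N s = p := by
      intro s hs
      have h1 := hmod s hs
      have h2 := hle s
      rw [h0] at h1
      rcases h2.lt_or_eq with h | h
      · left; rwa [Nat.mod_eq_of_lt h] at h1
      · exact Or.inr h
    have hN0 : N 0 = 1 := by
      rw [h0, zero_add, Nat.mod_eq_of_lt (by omega : 1 < p)] at hmod0
      rcases hle0.lt_or_eq with h | h
      · rwa [Nat.mod_eq_of_lt h] at hmod0
      · rw [h, Nat.mod_self] at hmod0; omega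
    have hT : ((Finset.univ.erase (0 : ZMod p)).filter fun s => N s = p).card = 2 := by
      have h1 : ∑ s ∈ Finset.univ.erase (0 : ZMod p), N s =
          ∑ s ∈ (Finset.univ.erase (0 : ZMod p)).filter (fun s => N s = p), p := by
        rw [Finset.sum_filter]
        refine Finset.sum_congr rfl fun s hs => ?_
        rcases hval s (Finset.ne_of_mem_erase hs) with h | h
        · rw [h, if_neg (by omega)]
        · rw [h, if_pos rfl]
      rw [h1, Finset.sum_const, smul_eq_mul, hN0] at htot
      exact Nat.eq_of_mul_eq_mul_right hp.pos (by omega)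
    obtain ⟨s, t, hst, hTeq⟩ := Finset.card_eq_two.mp hT
    have hmem : ∀ r, r ∈ ({s, t} : Finset (ZMod p)) → r ≠ 0 ∧ ∀ x, f x = r → x ∈ A := by
      intro r hr
      rw [← hTeq, Finset.mem_filter] at hr
      refine ⟨Finset.ne_of_mem_erase hr.1, fun x hx => ?_⟩
      have heq := Finset.eq_of_subset_of_card_le (hsub r)
        (by rw [card_fiber_of_surjective f hsurj r]; exact hr.2.ge)
      have : x ∈ Finset.univ.filter fun x => f x = r := by simpa using hx
      rw [← heq] at this
      exact (Finset.mem_filter.mp this).1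
    obtain ⟨z, hz⟩ := Finset.card_pos.mp (show 0 < N 0 by omega)
    rw [Finset.mem_filter] at hz
    have hs := hmem s (by simp)
    have ht := hmem t (by simp)
    exact absurd (le_card_restrictedSumset_of_fibers hp5 f hsurj hst hs.1 ht.1 hs.2 ht.2 hz.1 hz.2)
      (not_le.mpr hlt)
  · have hval : ∀ s ∈ Finset.univ.erase (0 : ZMod p), N s = c.val := by
      intro s hs
      have h1 := hmod s (Finset.ne_of_mem_erase hs)
      rcases (hle s).lt_or_eq with h | h
      · rwa [Nat.mod_eq_of_lt h] at h1
      · rw [h, Nat.mod_self] at h1; omega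
    rw [Finset.sum_congr rfl hval, Finset.sum_const, Finset.card_erase_of_mem (Finset.mem_univ _),
      Finset.card_univ, ZMod.card, smul_eq_mul] at htot
    obtain ⟨q, rfl⟩ : ∃ q, p = q + 1 := ⟨p - 1, by omega⟩
    rw [Nat.add_sub_cancel] at htot
    have hc3 : c.val < 3 := by
      by_contra hge
      have : q * 3 ≤ q * c.val := Nat.mul_le_mul_left _ (not_lt.mp hge)
      omega
    change N 0 = 3
    have : c.val = 1 ∨ c.val = 2 := by omega
    rcases this with h | h <;> rw [h] at htot <;> omega

/-- A nonzero point lies on exactly one of the `p + 1` lines through the origin, the origin on all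
of them. -/
theorem sum_card_filter_affineSlope (A : Finset (ZMod p × ZMod p)) :
    ∑ t, (A.filter fun a => affineSlope t a = 0).card + (A.filter fun a => a.2 = 0).card =
      A.card + if 0 ∈ A then p else 0 := by
  have hpt : ∀ a : ZMod p × ZMod p, (∑ t : ZMod p, if affineSlope t a = 0 then 1 else 0) +
      (if a.2 = 0 then 1 else 0) = 1 + if a = 0 then p else 0 := by
    rintro ⟨u, v⟩
    simp only [affineSlope_apply, Prod.mk_eq_zero]
    by_cases hv : v = 0
    · subst hv
      by_cases hu : u = 0 <;> simp [hu, ZMod.card, add_comm]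
    · have : ∀ t : ZMod p, u + v * t = 0 ↔ t = -u / v := fun t => by
        rw [eq_div_iff hv]
        exact ⟨fun h => by linear_combination h, fun h => by linear_combination h⟩
      simp [hv, this]
  simp_rw [Finset.card_filter]
  rw [Finset.sum_comm, ← Finset.sum_add_distrib, Finset.sum_congr rfl fun a _ => hpt a,
    Finset.sum_add_distrib]
  simp

theorem le_card_restrictedSumset_of_sum_eq_zero (hp5 : 5 ≤ p) {A : Finset (ZMod p × ZMod p)}
    (hA : A.card = 2 * p + 1) (h0 : ∑ a ∈ A, a = 0) : 4 * p ≤ (restrictedSumset A A).card := by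
  by_contra! hlt
  have h1 : ∀ t, (A.filter fun a => affineSlope t a = 0).card = 3 := fun t =>
    card_filter_eq_three hp5 hA hlt _ (fun s => ⟨(s, 0), by simp⟩)
      fun j hj0 hj => sum_affineSlope_pow_eq_zero hp5 hA h0 hlt t hj0 hj
  have h2 : (A.filter fun a => a.2 = 0).card = 3 := by
    let σ : ZMod p × ZMod p ≃+ ZMod p × ZMod p := AddEquiv.prodComm
    have hσ : Function.Injective σ.toAddMonoidHom := σ.injective
    refine card_filter_eq_three hp5 hA hlt (AddMonoidHom.snd _ _) (fun s => ⟨(0, s), rfl⟩)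
      fun j hj0 hj => ?_
    have := sum_affineSlope_pow_eq_zero hp5 (A := A.image σ.toAddMonoidHom)
      (by rw [Finset.card_image_of_injective _ hσ, hA])
      (by rw [Finset.sum_image hσ.injOn, ← map_sum, h0, map_zero])
      (by rwa [card_restrictedSumset_image _ hσ]) 0 hj0 hj
    rw [Finset.sum_image hσ.injOn] at this
    simpa [σ] using this
  have h3 := sum_card_filter_affineSlope A
  rw [Finset.sum_congr rfl fun t _ => h1 t, h2, hA, Finset.sum_const, Finset.card_univ, ZMod.card,
    smul_eq_mul] at h3
  -- The count `3 * (p + 1)` would equal `2 * p + 1` or `3 * p + 1`.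
  split_ifs at h3 <;> omega

theorem le_card_restrictedSumset (hp5 : 5 ≤ p) {A : Finset (ZMod p × ZMod p)}
    (hA : A.card = 2 * p + 1) : 4 * p ≤ (restrictedSumset A A).card := by
  -- Translating by `c` changes the sum of `A` by `(2 * p + 1) • c = c`, so this choice makes it
  -- zero.
  have hinj := add_left_injective (-∑ a ∈ A, a)
  rw [← card_restrictedSumset_image_add A (-∑ a ∈ A, a)]
  refine le_card_restrictedSumset_of_sum_eq_zero hp5
    (by rw [Finset.card_image_of_injective _ hinj, hA]) ?_
  rw [Finset.sum_image hinj.injOn, Finset.sum_add_distrib, Finset.sum_const, hA]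
  have hpz : ∀ x : ZMod p × ZMod p, p • x = 0 := fun x => by
    ext <;> simp
  rw [add_smul, mul_smul, hpz, smul_zero, zero_add, one_smul, add_neg_cancel]

/-- Two parallel lines together with a point on the line next to them have at most `4 * p`
restricted sums. -/
theorem exists_card_restrictedSumset_le (hp5 : 5 ≤ p) : ∃ A : Finset (ZMod p × ZMod p),
    A.card = 2 * p + 1 ∧ (restrictedSumset A A).card ≤ 4 * p := by
  have c1 : (1 : ZMod p) ≠ 0 := one_ne_zero
  have c2 : (2 : ZMod p) ≠ 0 := by
    exact_mod_cast natCast_ne_zero_of_lt (K := ZMod p) (p := p) two_pos (by omega)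
  have c21 : (2 : ZMod p) ≠ 1 := fun h => c1 (by linear_combination h)
  refine ⟨insert (2, 0) (({0, 1} : Finset (ZMod p)) ×ˢ (Finset.univ : Finset (ZMod p))), ?_, ?_⟩
  · rw [Finset.card_insert_of_notMem (by simp [c2, c21]), Finset.card_product,
      Finset.card_pair c1.symm, Finset.card_univ, ZMod.card]
  · have hsub : restrictedSumset
        (insert (2, 0) (({0, 1} : Finset (ZMod p)) ×ˢ (Finset.univ : Finset (ZMod p))))
        (insert (2, 0) (({0, 1} : Finset (ZMod p)) ×ˢ (Finset.univ : Finset (ZMod p)))) ⊆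
        ({0, 1, 2, 3} : Finset (ZMod p)) ×ˢ (Finset.univ : Finset (ZMod p)) := by
      intro x hx
      obtain ⟨a, ha, b, hb, hab, rfl⟩ := mem_restrictedSumset.mp hx
      simp only [Finset.mem_insert, Finset.mem_product, Finset.mem_singleton, Finset.mem_univ,
        and_true] at ha hb
      simp only [Finset.mem_product, Finset.mem_insert, Finset.mem_singleton, Finset.mem_univ,
        and_true, Prod.fst_add]
      rcases ha with rfl | ha | ha <;> rcases hb with rfl | hb | hb
      · exact absurd rfl hab
      all_goals simp only [*]; norm_num
    refine (Finset.card_le_card hsub).trans ?_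
    rw [Finset.card_product, Finset.card_univ, ZMod.card]
    exact Nat.mul_le_mul_right _ Finset.card_le_four

end Plane

theorem theorem1p4 (p : ℕ) (hp : p.Prime) (hp5 : 5 ≤ p) :
    rho (ZMod p × ZMod p) (2 * p + 1) = 4 * p := by
  have := Fact.mk hp
  obtain ⟨A, hA, hle⟩ := exists_card_restrictedSumset_le hp5
  have hleast := isLeast_rho (ZMod p × ZMod p) (2 * p + 1) ⟨A, hA⟩
  obtain ⟨B, hB, hBr⟩ := hleast.1
  exact le_antisymm ((hleast.2 ⟨A, hA, rfl⟩).trans hle) (hBr ▸ le_card_restrictedSumset hp5 hB)
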